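/- Let $N=n+d$ with $n,d\ge 0$. A *formal generic submanifold* $M$ of codimension $d$ (and CR dimension $n$) through $0\in\mathbb C^N$ is given by $\rho=(\rho_1,\dots,\rho_d)\in\mathbb C[\![Z,\zeta]\!]^d$, $Z=(Z_1,\dots,Z_N)$, $\zeta=(\zeta_1,\dots,\zeta_N)$, with $\rho(0)=0$, $\rho(Z,\zeta)=\bar\rho(\zeta,Z)$ and $\partial_Z\rho_1(0)\wedge\dots\wedge\partial_Z\rho_d(0)\ne 0$ (a bar over a series means conjugation of its coefficients). *Normal coordinates* $(z,w)\in\mathbb C^n\times\mathbb C^d$ for $M$ at $0$ are given by a formal invertible change of coordinates $Z=Z(z,w)$, $Z(0)=0$, such that $$\rho(Z(z,w),\bar Z(\chi,\tau))=a(z,w,\chi,\tau)\,\bigl(w-Q(z,\chi,\tau)\bigr),$$ where $a$ is an invertible $d\times d$ matrix of formal power series and $Q\in\mathbb C[\![z,\chi,\tau]\!]^d$ satisfies $Q(0,\chi,\tau)=Q(z,0,\tau)=\tau$. Write $Q^j(z,\chi,0)=\sum_\alpha q^j_\alpha(\chi)z^\alpha$, $j=1,\dots,d$. $M$ is *essentially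 finite* at $0$ if the ideal of $\mathbb C[\![\chi]\!]$ generated by all the $q^j_\alpha$ has finite codimension. Let $M,\widetilde M$ be formal generic submanifolds of the same codimension $d$ through $0\in\mathbb C^N$, with defining series $\rho,\tilde\rho$, and let $H\colon(\mathbb C^N,0)\to(\mathbb C^N,0)$ be a formal holomorphic mapping (i.e. $H\in\mathbb C[\![Z]\!]^N$, $H(0)=0$) sending $M$ into $\widetilde M$, i.e. $\tilde\rho(H(Z),\bar H(\zeta))=c(Z,\zeta)\rho(Z,\zeta)$ for some $d\times d$ matrix $c$ of formal power series. In normal coordinates $(\tilde z,\tilde w)$ for $\widetilde M$ write $H=(F,G)$ with $F$ having $n$ and $G=(G_1,\dots,G_d)$ having $d$ components. $H$ is *transversally regular* to $\widetilde M$ at $0$ if the ring $\mathbb C[\![Z]\!]/(G_1(Z),\dots,G_d(Z))$ has Krull dimension $n=N-d$. $H$ is *Segre finite* if, $F$ being written in normal coordinates $(z,w)$ for $M$, the mapping $z\mapsto F(z,0)$ is finite, i.e. the ideal generated by the components of $F(z,0)$ has finite codimension in $\mathbb C[\![z]\!]$. **Theorem.** If $M$ is essentially finite at $0$ (in some normal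 coordinates for $M$) and $H$ is transversally regular to $\widetilde M$ at $0$ (in some normal coordinates for $\widetilde M$), then $H$ is Segre finite (in every choice of normal coordinates for $M$ and $\widetilde M$). -/

import Mathlib

noncomputable section

namespace FormalCR

/-- A tuple of formal power series `f = (f_i)_{i : τ}` in the variables indexed by `σ`, viewed as a
formal mapping `ℂ^σ → ℂ^τ`. It maps `0` to `0` when `FixesZero f` holds. -/
abbrev FormalTuple (σ τ : Type) : Type := τ → MvPowerSeries σ ℂ

/-- No component has a constant term, i.e. `f : (ℂ^σ, 0) → (ℂ^τ, 0)`. -/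
def FixesZero {σ τ : Type} (f : FormalTuple σ τ) : Prop :=
  ∀ i, MvPowerSeries.constantCoeff (f i) = 0

/-- The composition `f ∘ g` of formal mappings (used only when `g` maps `0` to `0`). -/
def compose {σ τ υ : Type} (f : FormalTuple τ υ) (g : FormalTuple σ τ) : FormalTuple σ υ :=
  fun i => MvPowerSeries.subst g (f i)

/-- The identity mapping. -/
def idTuple (σ : Type) : FormalTuple σ σ := fun i => MvPowerSeries.X i

/-- The mapping whose components are the coordinate functions `x_{e i}`. -/
def coords {σ τ : Type} (e : τ → σ) : FormalTuple σ τ := fun i => MvPowerSeries.X (e i)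

/-- `f ↦ f̄`: every coefficient is replaced by its complex conjugate. -/
def conj {σ τ : Type} (f : FormalTuple σ τ) : FormalTuple σ τ :=
  fun i => MvPowerSeries.map (starRingEnd ℂ) (f i)

/-- The mapping `(x, y) ↦ (f(x), f̄(y))` on the doubled variables. -/
def complexify {σ τ : Type} (f : FormalTuple σ τ) : FormalTuple (σ ⊕ σ) (τ ⊕ τ) :=
  Sum.elim (compose f (coords Sum.inl)) (compose (conj f) (coords Sum.inr))

/-- The ideal `I(f)` generated by the components of `f`. -/
def compIdeal {σ τ : Type} (f : FormalTuple σ τ) : Ideal (MvPowerSeries σ ℂ) :=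
  Ideal.span (Set.range f)

/-- An ideal of finite codimension: `dim_ℂ ℂ[[x]] / I < ∞`. -/
def FiniteCodim {σ : Type} (I : Ideal (MvPowerSeries σ ℂ)) : Prop :=
  Module.Finite ℂ (MvPowerSeries σ ℂ ⧸ I)

/-- A finite formal mapping. -/
def IsFiniteMap {σ τ : Type} (f : FormalTuple σ τ) : Prop :=
  FiniteCodim (compIdeal f)

/-- A formal generic submanifold of codimension `d` (and CR dimension `n`) through `0` in `ℂ^N`,
`N = n + d`, given by its defining series `ρ(Z, ζ)`. The variables `Z` are indexed by `Sum.inl`,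
the variables `ζ` by `Sum.inr`. -/
structure GenericSubmanifold (n d : ℕ) where
  /-- the defining series `ρ(Z, ζ)` -/
  rho : FormalTuple (Fin (n + d) ⊕ Fin (n + d)) (Fin d)
  /-- `ρ(0) = 0` -/
  rho_zero : FixesZero rho
  /-- the reality condition `ρ(Z, ζ) = ρ̄(ζ, Z)` -/
  reality : rho = compose (conj rho) (coords Sum.swap)
  /-- `∂_Z ρ_1(0) ∧ … ∧ ∂_Z ρ_d(0) ≠ 0` -/
  generic : LinearIndependent ℂ
    (fun (j : Fin d) (k : Fin (n + d)) =>
      MvPowerSeries.coeff (Finsupp.single (Sum.inl k) 1) (rho j))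

/-- `H(M) ⊂ M'`: there is a `d × d` matrix `c(Z, ζ)` of formal power series with
`ρ'(H(Z), H̄(ζ)) = c(Z, ζ) ρ(Z, ζ)`. -/
def MapsInto {n d : ℕ} (H : FormalTuple (Fin (n + d)) (Fin (n + d)))
    (M M' : GenericSubmanifold n d) : Prop :=
  ∃ c : Matrix (Fin d) (Fin d) (MvPowerSeries (Fin (n + d) ⊕ Fin (n + d)) ℂ),
    compose M'.rho (complexify H) = c.mulVec M.rho

/-- Normal coordinates `(z, w)` for `M` at `0`: a formal invertible change of coordinates
`Z = Z(z, w)` (with inverse `Z ↦ (z(Z), w(Z))`) and a series `Q(z, χ, τ)` such that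
`ρ(Z(z, w), Z̄(χ, τ)) = a(z, w, χ, τ) (w - Q(z, χ, τ))` with `a` an invertible matrix of power series,
and `Q(0, χ, τ) = Q(z, 0, τ) = τ`. -/
structure NormalCoordinates {n d : ℕ} (M : GenericSubmanifold n d) where
  /-- the change of coordinates `Z = Z(z, w)` -/
  chart : FormalTuple (Fin n ⊕ Fin d) (Fin (n + d))
  /-- its inverse `Z ↦ (z(Z), w(Z))` -/
  inv : FormalTuple (Fin (n + d)) (Fin n ⊕ Fin d)
  chart_zero : FixesZero chart
  inv_zero : FixesZero inv
  chart_inv : compose chart inv = idTuple (Fin (n + d))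
  inv_chart : compose inv chart = idTuple (Fin n ⊕ Fin d)
  /-- the series `Q(z, χ, τ)` -/
  Q : FormalTuple (Fin n ⊕ (Fin n ⊕ Fin d)) (Fin d)
  /-- the matrix `a(z, w, χ, τ)` -/
  a : Matrix (Fin d) (Fin d) (MvPowerSeries ((Fin n ⊕ Fin d) ⊕ (Fin n ⊕ Fin d)) ℂ)
  a_isUnit : IsUnit a
  /-- `ρ(Z(z, w), Z̄(χ, τ)) = a(z, w, χ, τ) (w - Q(z, χ, τ))` -/
  equation : compose M.rho (complexify chart) =
    a.mulVec (coords (fun j => Sum.inl (Sum.inr j)) -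
      compose Q (coords (Sum.map Sum.inl id)))
  /-- `Q(0, χ, τ) = τ` -/
  Q_left : compose Q (Sum.elim (fun _ => 0) (coords id)) =
    (coords Sum.inr : FormalTuple (Fin n ⊕ Fin d) (Fin d))
  /-- `Q(z, 0, τ) = τ` -/
  Q_mid : compose Q (Sum.elim (coords Sum.inl) (Sum.elim (fun _ => 0) (coords Sum.inr))) =
    (coords Sum.inr : FormalTuple (Fin n ⊕ Fin d) (Fin d))

/-- The coefficient `q^j_α(χ)` of `z^α` in `Q^j(z, χ, 0) = ∑_α q^j_α(χ) z^α`. -/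
def NormalCoordinates.q {n d : ℕ} {M : GenericSubmanifold n d} (x : NormalCoordinates M)
    (j : Fin d) (α : Fin n →₀ ℕ) : MvPowerSeries (Fin n) ℂ :=
  fun β => MvPowerSeries.coeff (Finsupp.sumElim α (Finsupp.sumElim β 0)) (x.Q j)

/-- The essential ideal of `M` at `0`, computed in the normal coordinates `x`: the ideal of `ℂ[[χ]]`
generated by all `q^j_α(χ)`. -/
def NormalCoordinates.essentialIdeal {n d : ℕ} {M : GenericSubmanifold n d}
    (x : NormalCoordinates M) : Ideal (MvPowerSeries (Fin n) ℂ) :=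
  Ideal.span (Set.range (fun p : Fin d × (Fin n →₀ ℕ) => x.q p.1 p.2))

/-- `M` is essentially finite at `0`. The condition does not depend on the normal coordinates;
as a hypothesis it is required in one system of normal coordinates only. -/
def EssentiallyFinite {n d : ℕ} (M : GenericSubmanifold n d) : Prop :=
  ∃ x : NormalCoordinates M, FiniteCodim x.essentialIdeal

/-- The component `F` of `H = (F, G)` in the normal coordinates `y = (z̃, w̃)` of the target. -/
def NormalCoordinates.compF {n d : ℕ} {M' : GenericSubmanifold n d} (y : NormalCoordinates M')
    (H : FormalTuple (Fin (n + d)) (Fin (n + d))) : FormalTuple (Fin (n + d)) (Fin n) :=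
  compose (fun i => y.inv (Sum.inl i)) H

/-- The component `G` of `H = (F, G)` in the normal coordinates `y = (z̃, w̃)` of the target. -/
def NormalCoordinates.compG {n d : ℕ} {M' : GenericSubmanifold n d} (y : NormalCoordinates M')
    (H : FormalTuple (Fin (n + d)) (Fin (n + d))) : FormalTuple (Fin (n + d)) (Fin d) :=
  compose (fun j => y.inv (Sum.inr j)) H

/-- `H` is transversally regular to `M'` at `0`: the ring `ℂ[[Z]] / I(G(Z))` has Krull dimension
`n = N - d`. The condition does not depend on the normal coordinates for `M'`; as a hypothesis it is
required in one system of normal coordinates only. -/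
def TransversallyRegular {n d : ℕ} (H : FormalTuple (Fin (n + d)) (Fin (n + d)))
    (M' : GenericSubmanifold n d) : Prop :=
  ∃ y : NormalCoordinates M',
    ringKrullDim (MvPowerSeries (Fin (n + d)) ℂ ⧸ compIdeal (y.compG H)) = (n : WithBot ℕ∞)

/-- The first Segre mapping `v¹(t) = (t, 0)`, in normal coordinates `(z, w)`. -/
def segreOne (n d : ℕ) : FormalTuple (Fin n) (Fin n ⊕ Fin d) :=
  Sum.elim (idTuple (Fin n)) (fun _ => 0)

/-- `H` is Segre finite (as a mapping from `M` to `M'`): `F ∘ v¹ : (ℂⁿ, 0) → (ℂⁿ, 0)` is a finite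
formal mapping, where `F` is written in normal coordinates for `M` and `M'`. The condition does not
depend on the normal coordinates; it is asserted here for all of them. -/
def SegreFinite {n d : ℕ} (H : FormalTuple (Fin (n + d)) (Fin (n + d)))
    (M M' : GenericSubmanifold n d) : Prop :=
  ∀ (x : NormalCoordinates M) (y : NormalCoordinates M'),
    IsFiniteMap (compose (compose (y.compF H) x.chart) (segreOne n d))

end FormalCR

end

/-!
Suppose that `z ↦ H(Z(z, 0))` is not finite. Then its components lie in a prime `P` of `ℂ[[z]]` not
containing all the variables, and `θ : f ↦ f̄ mod P` kills the components of `H̄(Z̄(χ, 0))`. The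
points `(Z(z, Q(z, χ, 0)), Z̄(χ, 0))` satisfy `ρ = 0`, hence
`ρ'(H(Z(z, Q(z, χ, 0))), H̄(Z̄(χ, 0))) = 0`. Therefore `Φ : ℂ[[Z]] → (ℂ[[χ]] / ker θ)[[z]]`, given
by the substitution `Z = Z(z, Q(z, χ, 0))` followed by `θ` on the coefficients, sends `ρ'(H(Z), 0)`
to `0`, and with it the ideal `(G)`. Setting `χ = 0` makes `ℂ[[Z]] / ker Φ` surject onto `ℂ[[z]]`.
The coordinates `w` are killed there, but not all of them by `Φ`, since `Φ(w) = Q(z, χ, 0)` and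
`M` is essentially finite. So the domain `ℂ[[Z]] / ker Φ`, a quotient of `ℂ[[Z]] / (G)`, has
dimension at least `n + 1`, contradicting transversal regularity.
-/

noncomputable section

namespace FormalCR

open MvPowerSeries

section PowerSeries

variable {σ τ R S K : Type*} [CommRing R] [CommRing S] [Field K]

theorem mem_span_X_image (s : Finset σ) {f : MvPowerSeries σ R}
    (hf : ∀ m : σ →₀ ℕ, (∀ i ∈ s, m i = 0) → coeff m f = 0) :
    f ∈ Ideal.span (X '' (s : Set σ)) := by
  classical
  induction s using Finset.induction_on generalizing f with
  | empty =>
    have : f = 0 := ext fun m => hf m (by simp)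
    simp [this]
  | insert i s _ ih =>
    let g : MvPowerSeries σ R := fun m => if m i = 0 then 0 else coeff m f
    have coeff_g (m) : coeff m g = if m i = 0 then 0 else coeff m f := rfl
    have hg : X i ∣ g := X_dvd_iff.2 fun m hm => by rw [coeff_g, if_pos hm]
    have hfg : f - g ∈ Ideal.span (X '' (s : Set σ)) := ih fun m hm => by
      rw [map_sub, coeff_g]
      split_ifs with hi
      · rw [hf m (Finset.forall_mem_insert _ _ _ |>.2 ⟨hi, hm⟩), sub_zero]
      · exact sub_self _
    rw [← sub_add_cancel f g]
    refine add_mem (Ideal.span_mono (Set.image_mono (by simp)) hfg) ?_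
    exact Ideal.mem_of_dvd _ hg (Ideal.subset_span ⟨i, by simp, rfl⟩)

theorem sub_C_constantCoeff_mem_span_X [Finite σ] (f : MvPowerSeries σ R) :
    f - C (constantCoeff f) ∈ Ideal.span (Set.range X) := by
  classical
  cases nonempty_fintype σ
  simpa using mem_span_X_image (Finset.univ : Finset σ) (f := f - C (constantCoeff f))
    fun m hm => by
      obtain rfl : m = 0 := Finsupp.ext fun i => hm i (Finset.mem_univ i)
      simp

theorem finite_quotient_of_X_mem_prime [Finite σ] (I : Ideal (MvPowerSeries σ K))
    (hI : ∀ P : Ideal (MvPowerSeries σ K), P.IsPrime → I ≤ P → ∀ i, X i ∈ P) :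
    Module.Finite K (MvPowerSeries σ K ⧸ I) := by
  have span_X_le : Ideal.span (Set.range X) ≤ I.radical := by
    rw [Ideal.radical_eq_sInf]
    refine le_sInf fun P hP => Ideal.span_le.2 ?_
    rintro _ ⟨i, rfl⟩
    exact hI P hP.2 hP.1 i
  have finite_radical : Module.Finite K (MvPowerSeries σ K ⧸ I.radical) := by
    refine Module.Finite.of_surjective (Algebra.linearMap K _) fun q => ?_
    obtain ⟨f, rfl⟩ := Ideal.Quotient.mk_surjective q
    exact ⟨constantCoeff f,
      (Ideal.Quotient.eq.2 (span_X_le (sub_C_constantCoeff_mem_span_X f))).symm⟩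
  refine Module.finite_of_surjective_of_ker_le_nilradical
    (Ideal.Quotient.factorₐ K I.le_radical) (Ideal.Quotient.factor_surjective I.le_radical)
    ?_ (IsNoetherian.noetherian _)
  intro q hq
  obtain ⟨f, rfl⟩ := Ideal.Quotient.mk_surjective q
  obtain ⟨k, hk⟩ : f ∈ I.radical := Ideal.Quotient.eq_zero_iff_mem.1 hq
  exact mem_nilradical.2 ⟨k, by rwa [← map_pow, Ideal.Quotient.eq_zero_iff_mem]⟩

theorem X_mem_prime_of_finite_quotient {I : Ideal (MvPowerSeries σ K)}
    [Module.Finite K (MvPowerSeries σ K ⧸ I)] {P : Ideal (MvPowerSeries σ K)} [P.IsPrime]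
    (hIP : I ≤ P) (i : σ) : X i ∈ P := by
  have : Module.Finite K (MvPowerSeries σ K ⧸ P) :=
    Module.Finite.of_surjective (Ideal.Quotient.factorₐ K hIP).toLinearMap
      (Ideal.Quotient.factor_surjective hIP)
  have hmax : P.IsMaximal := Ideal.Quotient.maximal_of_isField P
    (isField_of_isIntegral_of_isField' (Field.toIsField K))
  rw [IsLocalRing.eq_maximalIdeal hmax, IsLocalRing.mem_maximalIdeal, mem_nonunits_iff,
    isUnit_iff_constantCoeff, constantCoeff_X]
  exact not_isUnit_zero

theorem natCast_le_ringKrullDim (n : ℕ) :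
    (n : WithBot ℕ∞) ≤ ringKrullDim (MvPowerSeries (Fin n) K) := by
  induction n with
  | zero => simpa using ringKrullDim_nonneg_of_nontrivial
  | succ n ih =>
    rw [ringKrullDim_eq_of_ringEquiv (finSuccEquiv K n).toRingEquiv]
    refine le_trans ?_ ringKrullDim_succ_le_ringKrullDim_powerseries
    push_cast
    gcongr

theorem ringKrullDim_add_one_le_quotient {A B C : Type*} [CommRing A] [CommRing B] [IsDomain B]
    [CommRing C] {I : Ideal A} {Φ : A →+* B} {ε : A →+* C} (hI : I ≤ RingHom.ker Φ)
    (hε : Function.Surjective ε) (hΦε : RingHom.ker Φ ≤ RingHom.ker ε) {w : A}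
    (hΦw : Φ w ≠ 0) (hεw : ε w = 0) :
    ringKrullDim C + 1 ≤ ringKrullDim (A ⧸ I) := by
  have hw : Ideal.Quotient.mk (RingHom.ker Φ) w ≠ 0 := by
    rwa [Ne, Ideal.Quotient.eq_zero_iff_mem, RingHom.mem_ker]
  have : (RingHom.ker Φ).IsPrime := RingHom.ker_isPrime Φ
  calc
    ringKrullDim C + 1 ≤ ringKrullDim (A ⧸ RingHom.ker Φ) :=
      ringKrullDim_succ_le_of_surjective (Ideal.Quotient.lift _ ε hΦε)
        (Ideal.Quotient.lift_surjective_of_surjective _ _ hε)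
        (mem_nonZeroDivisors_of_ne_zero hw) hεw
    _ ≤ ringKrullDim (A ⧸ I) :=
      ringKrullDim_le_of_surjective (Ideal.Quotient.factor hI)
        (Ideal.Quotient.factor_surjective hI)

/-- A power series in `x` and `y`, viewed as a power series in `x` whose coefficients are power
series in `y`. -/
def sumToIterFun (f : MvPowerSeries (σ ⊕ τ) R) : MvPowerSeries σ (MvPowerSeries τ R) :=
  fun α => (fun β => coeff (Finsupp.sumElim α β) f : MvPowerSeries τ R)

theorem coeff_coeff_sumToIterFun (f : MvPowerSeries (σ ⊕ τ) R) (α : σ →₀ ℕ) (β : τ →₀ ℕ) :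
    coeff β (coeff α (sumToIterFun f)) = coeff (Finsupp.sumElim α β) f := rfl

theorem sumToIterFun_one : sumToIterFun (1 : MvPowerSeries (σ ⊕ τ) R) = 1 := by
  classical
  ext α β
  have sumElim_eq_zero : Finsupp.sumElim α β = 0 ↔ α = 0 ∧ β = 0 := by
    rw [← Finsupp.sumElim_zero_zero]
    exact Finsupp.sumFinsuppEquivProdFinsupp.symm.injective.eq_iff.trans Prod.mk_inj
  simp only [coeff_coeff_sumToIterFun, coeff_one, sumElim_eq_zero, ite_and, apply_ite (coeff β),
    map_zero]

theorem sumToIterFun_mul (f g : MvPowerSeries (σ ⊕ τ) R) :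
    sumToIterFun (f * g) = sumToIterFun f * sumToIterFun g := by
  classical
  ext α β
  simp only [coeff_coeff_sumToIterFun, coeff_mul, map_sum]
  rw [← Finset.sum_product']
  refine Finset.sum_equiv ((Finsupp.sumFinsuppEquivProdFinsupp.prodCongr
    Finsupp.sumFinsuppEquivProdFinsupp).trans (Equiv.prodProdProdComm _ _ _ _)) ?_ ?_
  · rintro ⟨p, q⟩
    simp [Finset.HasAntidiagonal.mem_antidiagonal, Finsupp.ext_iff, Sum.forall]
  · rintro ⟨p, q⟩ _
    simp

/-- The ring homomorphism `R[[x, y]] → R[[y]][[x]]` that collects the powers of `x`, the power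
series analogue of `MvPolynomial.sumToIter`. -/
def sumToIter : MvPowerSeries (σ ⊕ τ) R →+* MvPowerSeries σ (MvPowerSeries τ R) where
  toFun := sumToIterFun
  map_zero' := rfl
  map_one' := sumToIterFun_one
  map_add' _ _ := rfl
  map_mul' := sumToIterFun_mul

theorem coeff_coeff_sumToIter (f : MvPowerSeries (σ ⊕ τ) R) (α : σ →₀ ℕ) (β : τ →₀ ℕ) :
    coeff β (coeff α (sumToIter f)) = coeff (Finsupp.sumElim α β) f := rfl

theorem sumToIter_rename_inr (f : MvPowerSeries τ R) :
    sumToIter (rename (Function.Embedding.inr : τ ↪ σ ⊕ τ) f) = C f := by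
  classical
  ext α β
  rw [coeff_coeff_sumToIter, coeff_C]
  split_ifs with h
  · rw [h, ← Finsupp.embDomain_inr, coeff_embDomain_rename]
  · rw [map_zero]
    apply coeff_rename_eq_zero
    rintro ⟨γ, hγ⟩
    refine h (Finsupp.ext fun i => ?_)
    simpa [Finsupp.mapDomain_of_notMem_range] using (DFunLike.congr_fun hγ (Sum.inl i) :).symm

theorem mem_span_X_of_killCompl_eq_zero [Finite τ] (e : σ ↪ τ) {f : MvPowerSeries τ R}
    (hf : killCompl e f = 0) : f ∈ Ideal.span (X '' (Set.range e)ᶜ) := by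
  have := mem_span_X_image (Set.range e)ᶜ.toFinite.toFinset (f := f) fun m hm => by
    have hsupp : (m.support : Set τ) ⊆ Set.range e := fun t ht => by
      by_contra hte
      exact Finsupp.mem_support_iff.1 ht (hm t (by simpa using hte))
    rw [← Finsupp.embDomain_comapDomain hsupp, ← coeff_killCompl, hf, map_zero]
  rwa [Set.Finite.coe_toFinset] at this

theorem subst_eq_killCompl [Finite τ] (e : σ ↪ τ) {a : τ → MvPowerSeries σ R} (ha : HasSubst a)
    (hae : ∀ i, a (e i) = X i) (ha0 : ∀ t ∉ Set.range e, a t = 0) (f : MvPowerSeries τ R) :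
    subst a f = killCompl e f := by
  have hle : Ideal.span (X '' (Set.range e)ᶜ) ≤ RingHom.ker (substAlgHom (R := R) ha) := by
    rw [Ideal.span_le]
    rintro _ ⟨t, ht, rfl⟩
    rw [SetLike.mem_coe, RingHom.mem_ker, substAlgHom_X, ha0 t ht]
  have := RingHom.mem_ker.1 <| hle <| mem_span_X_of_killCompl_eq_zero e
    (f := f - rename e (killCompl e f)) (by rw [map_sub, killCompl_rename_app, sub_self])
  rw [map_sub, sub_eq_zero, substAlgHom_apply, substAlgHom_apply, rename_eq_subst,
    subst_comp_subst_apply (HasSubst.X_comp e) ha] at this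
  simp only [subst_X ha, hae, Function.comp_apply] at this
  rwa [show subst (fun i => X i) (killCompl e f) = _ from congr_fun subst_self _] at this

/-- The ring homomorphism `R[[x, y]] → S[[x]]` induced by `θ : R[[y]] → S` on the coefficients of
the powers of `x`: series in `(x, y)` are restricted to the formal family of `x`-spaces over the
subscheme of `y`-space cut out by `ker θ`. -/
def fiberHom (θ : MvPowerSeries τ R →+* S) : MvPowerSeries (σ ⊕ τ) R →+* MvPowerSeries σ S :=
  (map θ).comp sumToIter

theorem coeff_fiberHom (θ : MvPowerSeries τ R →+* S) (f : MvPowerSeries (σ ⊕ τ) R)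
    (α : σ →₀ ℕ) : coeff α (fiberHom θ f) = θ (coeff α (sumToIter f)) :=
  coeff_map _ _ _

theorem fiberHom_subst_X_inr [Finite τ] (θ : MvPowerSeries τ R →+* S) (f : MvPowerSeries τ R) :
    fiberHom θ (subst (fun i => X (Sum.inr i) : τ → MvPowerSeries (σ ⊕ τ) R) f) = C (θ f) := by
  have : subst (fun i => X (Sum.inr i) : τ → MvPowerSeries (σ ⊕ τ) R) f =
      rename (Function.Embedding.inr : τ ↪ σ ⊕ τ) f := (rename_eq_subst _ _).symm
  rw [this, fiberHom, RingHom.comp_apply, sumToIter_rename_inr, map_C]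

theorem hasSubst_sumElim_X_zero [Finite σ] [Finite τ] :
    HasSubst (Sum.elim X 0 : σ ⊕ τ → MvPowerSeries σ R) :=
  hasSubst_of_constantCoeff_zero <| Sum.rec constantCoeff_X fun _ => map_zero _

theorem subst_sumElim_X_zero [Finite σ] [Finite τ] (f : MvPowerSeries (σ ⊕ τ) R) :
    subst (Sum.elim X 0) f = killCompl (Function.Embedding.inl : σ ↪ σ ⊕ τ) f :=
  subst_eq_killCompl _ hasSubst_sumElim_X_zero (fun _ => rfl)
    (by rintro (i | i) hi <;> simp at hi ⊢) f

theorem subst_sumElim_X_zero_eq_zero [Finite σ] [Finite τ] [Nontrivial S]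
    {θ : MvPowerSeries τ K →+* S} {f : MvPowerSeries (σ ⊕ τ) K} (hf : fiberHom θ f = 0) :
    subst (Sum.elim X 0 : σ ⊕ τ → MvPowerSeries σ K) f = 0 := by
  rw [subst_sumElim_X_zero]
  ext α
  rw [coeff_killCompl, Finsupp.embDomain_inl, ← coeff_coeff_sumToIter, map_zero]
  by_contra hne
  have hunit : IsUnit (coeff α (sumToIter f)) := isUnit_iff_constantCoeff.2 (.mk0 _ hne)
  refine (hunit.map θ).ne_zero ?_
  rw [← coeff_fiberHom, hf, map_zero]

theorem subst_add_sub_subst_mem [Finite σ] (f : MvPowerSeries σ R) :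
    subst (fun i => X (Sum.inl i) + X (Sum.inr i) : σ → MvPowerSeries (σ ⊕ σ) R) f -
      subst (fun i => X (Sum.inl i)) f ∈
      Ideal.span (X '' (Set.range (Function.Embedding.inl : σ ↪ σ ⊕ σ))ᶜ) := by
  have h_add : HasSubst (fun i => X (Sum.inl i) + X (Sum.inr i) : σ → MvPowerSeries (σ ⊕ σ) R) :=
    hasSubst_of_constantCoeff_zero fun i => by simp
  have h_inl : HasSubst (fun i => X (Sum.inl i) : σ → MvPowerSeries (σ ⊕ σ) R) :=
    hasSubst_of_constantCoeff_zero fun i => constantCoeff_X _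
  have h_zero : HasSubst (Sum.elim X 0 : σ ⊕ σ → MvPowerSeries σ R) := hasSubst_sumElim_X_zero
  refine mem_span_X_of_killCompl_eq_zero _ ?_
  rw [← subst_sumElim_X_zero, subst_sub h_zero, subst_comp_subst_apply h_add h_zero,
    subst_comp_subst_apply h_inl h_zero]
  simp [subst_add h_zero, subst_X h_zero]

theorem subst_sub_subst_mem [Finite σ] {I : Ideal (MvPowerSeries τ R)}
    {a b : σ → MvPowerSeries τ R} (ha : ∀ i, constantCoeff (a i) = 0)
    (hb : ∀ i, constantCoeff (b i) = 0) (hab : ∀ i, a i - b i ∈ I) (f : MvPowerSeries σ R) :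
    subst a f - subst b f ∈ I := by
  have h_add : HasSubst (fun i => X (Sum.inl i) + X (Sum.inr i) : σ → MvPowerSeries (σ ⊕ σ) R) :=
    hasSubst_of_constantCoeff_zero fun i => by simp
  have h_inl : HasSubst (fun i => X (Sum.inl i) : σ → MvPowerSeries (σ ⊕ σ) R) :=
    hasSubst_of_constantCoeff_zero fun i => constantCoeff_X _
  have h_eval : HasSubst (Sum.elim b (a - b)) :=
    hasSubst_of_constantCoeff_zero <| Sum.rec hb fun i => by simp [ha, hb]
  have hle : Ideal.span (X '' (Set.range (Function.Embedding.inl : σ ↪ σ ⊕ σ))ᶜ) ≤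
      I.comap (substAlgHom (R := R) h_eval) := by
    rw [Ideal.span_le]
    rintro _ ⟨i | i, hi, rfl⟩
    · simp at hi
    · rw [SetLike.mem_coe, Ideal.mem_comap, substAlgHom_X]
      exact hab i
  have := hle (subst_add_sub_subst_mem f)
  rw [Ideal.mem_comap, map_sub, substAlgHom_apply, substAlgHom_apply,
    subst_comp_subst_apply h_add h_eval, subst_comp_subst_apply h_inl h_eval] at this
  simpa [subst_add h_eval, subst_X h_eval] using this

theorem subst_mem [Finite σ] {I : Ideal (MvPowerSeries τ R)} {a : σ → MvPowerSeries τ R}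
    (ha : ∀ i, constantCoeff (a i) = 0) (haI : ∀ i, a i ∈ I) {f : MvPowerSeries σ R}
    (hf : constantCoeff f = 0) : subst a f ∈ I := by
  have := subst_sub_subst_mem (b := 0) ha (fun _ => map_zero _)
    (fun i => by rw [Pi.zero_apply, sub_zero]; exact haI i) f
  rwa [show subst (0 : σ → MvPowerSeries τ R) f = 0 from subst_zero_of_constantCoeff_zero hf,
    sub_zero] at this

end PowerSeries

section FormalTuple

variable {σ τ υ ω : Type}

theorem FixesZero.hasSubst [Finite τ] {f : FormalTuple σ τ} (hf : FixesZero f) : HasSubst f :=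
  hasSubst_of_constantCoeff_zero hf

theorem fixesZero_zero : FixesZero (0 : FormalTuple σ τ) := fun _ => map_zero _

theorem fixesZero_coords (e : τ → σ) : FixesZero (coords e) := fun _ => constantCoeff_X _

theorem fixesZero_idTuple : FixesZero (idTuple σ) := fun _ => constantCoeff_X _

theorem FixesZero.sumElim {f : FormalTuple σ τ} {g : FormalTuple σ υ} (hf : FixesZero f)
    (hg : FixesZero g) : FixesZero (Sum.elim f g : FormalTuple σ (τ ⊕ υ)) :=
  Sum.rec hf hg

theorem FixesZero.comp {f : FormalTuple σ τ} (hf : FixesZero f) (e : υ → τ) :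
    FixesZero (f ∘ e : FormalTuple σ υ) := fun i => hf (e i)

theorem FixesZero.compose [Finite τ] {f : FormalTuple τ υ} {g : FormalTuple σ τ}
    (hf : FixesZero f) (hg : FixesZero g) : FixesZero (compose f g) :=
  fun i => constantCoeff_subst_eq_zero hg.hasSubst hg (hf i)

theorem FixesZero.conj {f : FormalTuple σ τ} (hf : FixesZero f) : FixesZero (conj f) := fun i => by
  rw [FormalCR.conj, constantCoeff_map, hf i, map_zero]

theorem FixesZero.complexify [Finite σ] {f : FormalTuple σ τ} (hf : FixesZero f) :
    FixesZero (complexify f) :=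
  (hf.compose (fixesZero_coords _)).sumElim (hf.conj.compose (fixesZero_coords _))

theorem fixesZero_segreOne (n d : ℕ) : FixesZero (segreOne n d) :=
  fixesZero_idTuple.sumElim fixesZero_zero

theorem compose_assoc [Finite τ] [Finite υ] (f : FormalTuple υ ω) {g : FormalTuple τ υ}
    {h : FormalTuple σ τ} (hg : FixesZero g) (hh : FixesZero h) :
    compose (compose f g) h = compose f (compose g h) :=
  funext fun i => subst_comp_subst_apply hg.hasSubst hh.hasSubst (f i)

theorem idTuple_compose [Finite τ] {g : FormalTuple σ τ} (hg : FixesZero g) :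
    compose (idTuple τ) g = g :=
  funext fun i => subst_X hg.hasSubst i

theorem coords_compose [Finite τ] (e : υ → τ) {g : FormalTuple σ τ} (hg : FixesZero g) :
    compose (coords e) g = g ∘ e :=
  funext fun i => subst_X hg.hasSubst (e i)

theorem compose_sub [Finite τ] (f f' : FormalTuple τ υ) {g : FormalTuple σ τ}
    (hg : FixesZero g) : compose (f - f') g = compose f g - compose f' g :=
  funext fun i => subst_sub hg.hasSubst (f i) (f' i)

theorem zero_compose [Finite τ] {g : FormalTuple σ τ} (hg : FixesZero g) :
    compose (0 : FormalTuple τ υ) g = 0 :=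
  funext fun _ => by
    rw [compose, ← substAlgHom_apply (R := ℂ) hg.hasSubst, Pi.zero_apply, map_zero, Pi.zero_apply]

theorem compose_zero {f : FormalTuple τ υ} (hf : FixesZero f) :
    compose f (0 : FormalTuple σ τ) = 0 :=
  funext fun i => subst_zero_of_constantCoeff_zero (hf i)

theorem sumElim_compose (f : FormalTuple τ υ) (f' : FormalTuple τ ω) (g : FormalTuple σ τ) :
    compose (Sum.elim f f') g = Sum.elim (compose f g) (compose f' g) :=
  funext <| Sum.rec (fun _ => rfl) fun _ => rfl

theorem mulVec_compose [Finite τ] [Fintype υ] (a : Matrix ω υ (MvPowerSeries τ ℂ))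
    (v : FormalTuple τ υ) {g : FormalTuple σ τ} (hg : FixesZero g) :
    compose (a.mulVec v) g = (a.map (subst g)).mulVec (compose v g) := by
  funext i
  simp only [compose, Matrix.mulVec, dotProduct, Matrix.map_apply,
    ← substAlgHom_apply (R := ℂ) hg.hasSubst, map_sum, map_mul]

theorem complexify_compose [Finite τ] (f : FormalTuple τ υ) {A B : FormalTuple σ τ}
    (hA : FixesZero A) (hB : FixesZero B) :
    compose (complexify f) (Sum.elim A B) = Sum.elim (compose f A) (compose (conj f) B) := by
  have hAB := hA.sumElim hB
  rw [complexify, sumElim_compose, compose_assoc _ (fixesZero_coords _) hAB,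
    compose_assoc _ (fixesZero_coords _) hAB, coords_compose _ hAB, coords_compose _ hAB,
    Sum.elim_comp_inl, Sum.elim_comp_inr]

theorem conj_compose [Finite τ] (f : FormalTuple τ υ) {g : FormalTuple σ τ}
    (hg : FixesZero g) : conj (compose f g) = compose (conj f) (conj g) :=
  funext fun i => map_subst hg.hasSubst (f i)

theorem conj_segreOne (n d : ℕ) : conj (segreOne n d) = segreOne n d :=
  funext <| Sum.rec (fun _ => map_X _ _) fun _ => map_zero _

theorem segreOne_compose {n : ℕ} (d : ℕ) {g : FormalTuple σ (Fin n)} (hg : FixesZero g) :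
    compose (segreOne n d) g = Sum.elim g 0 := by
  rw [segreOne, sumElim_compose, idTuple_compose hg]
  exact congr_arg (Sum.elim g) (zero_compose hg)

theorem map_conj_conj (f : MvPowerSeries σ ℂ) :
    map (starRingEnd ℂ) (map (starRingEnd ℂ) f) = f := by
  ext m
  simp

theorem mem_compIdeal (f : FormalTuple σ τ) (i : τ) : f i ∈ compIdeal f :=
  Ideal.subset_span ⟨i, rfl⟩

theorem compIdeal_le_iff {f : FormalTuple σ τ} {I : Ideal (MvPowerSeries σ ℂ)} :
    compIdeal f ≤ I ↔ ∀ i, f i ∈ I :=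
  Ideal.span_le.trans Set.range_subset_iff

theorem compIdeal_compose_le [Finite τ] {f : FormalTuple τ υ} {g : FormalTuple σ τ}
    (hf : FixesZero f) (hg : FixesZero g) : compIdeal (compose f g) ≤ compIdeal g :=
  compIdeal_le_iff.2 fun i => subst_mem hg (mem_compIdeal g) (hf i)

theorem FiniteCodim.mono {I J : Ideal (MvPowerSeries σ ℂ)} (hI : FiniteCodim I) (hIJ : I ≤ J) :
    FiniteCodim J :=
  have : Module.Finite ℂ (MvPowerSeries σ ℂ ⧸ I) := hI
  Module.Finite.of_surjective (Ideal.Quotient.factorₐ ℂ hIJ).toLinearMap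
    (Ideal.Quotient.factor_surjective hIJ)

theorem surjective_substAlgHom [Finite σ] [Finite τ] {g : FormalTuple σ τ} {g' : FormalTuple τ σ}
    (hg : FixesZero g) (hg' : FixesZero g') (h : compose g' g = idTuple σ) :
    Function.Surjective (substAlgHom (R := ℂ) hg.hasSubst) := fun f => by
  refine ⟨subst g' f, ?_⟩
  rw [substAlgHom_apply, subst_comp_subst_apply hg'.hasSubst hg.hasSubst]
  exact (congr_arg (subst · f) h).trans (congr_fun subst_self f)

theorem IsFiniteMap.compose [Finite σ] [Finite τ] {f : FormalTuple τ υ} {g : FormalTuple σ τ}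
    {g' : FormalTuple τ σ} (hf : IsFiniteMap f) (hg : FixesZero g) (hg' : FixesZero g')
    (h : compose g' g = idTuple σ) : IsFiniteMap (compose f g) := by
  have : Module.Finite ℂ (MvPowerSeries τ ℂ ⧸ compIdeal f) := hf
  have hle : compIdeal f ≤ (compIdeal (FormalCR.compose f g)).comap
      (substAlgHom (R := ℂ) hg.hasSubst) :=
    compIdeal_le_iff.2 fun i => by
      rw [Ideal.mem_comap, substAlgHom_apply]
      exact mem_compIdeal (FormalCR.compose f g) i
  exact Module.Finite.of_surjective (Ideal.quotientMapₐ _ _ hle).toLinearMap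
    (Ideal.quotientMap_surjective (H := hle) (surjective_substAlgHom hg hg' h))

end FormalTuple

theorem mem_span_mulVec {A ι : Type*} [CommRing A] [Fintype ι] [DecidableEq ι] {a : Matrix ι ι A}
    (ha : IsUnit a) (v : ι → A) (j : ι) : v j ∈ Ideal.span (Set.range (a.mulVec v)) := by
  obtain ⟨u, rfl⟩ := ha
  have hv : v = (↑u⁻¹ : Matrix ι ι A).mulVec ((u : Matrix ι ι A).mulVec v) := by
    rw [Matrix.mulVec_mulVec, Units.inv_mul, Matrix.one_mulVec]
  rw [congr_fun hv j]
  exact sum_mem fun i _ => Ideal.mul_mem_left _ _ (Ideal.subset_span ⟨i, rfl⟩)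

theorem MapsInto.rho_compose_eq_zero {n d : ℕ} {H : FormalTuple (Fin (n + d)) (Fin (n + d))}
    {M M' : GenericSubmanifold n d} (h : MapsInto H M M') (hH : FixesZero H) {σ : Type}
    {A B : FormalTuple σ (Fin (n + d))} (hA : FixesZero A) (hB : FixesZero B)
    (hAB : compose M.rho (Sum.elim A B) = 0) :
    compose M'.rho (Sum.elim (compose H A) (compose (conj H) B)) = 0 := by
  obtain ⟨c, hc⟩ := h
  rw [← complexify_compose _ hA hB, ← compose_assoc _ hH.complexify (hA.sumElim hB), hc,
    mulVec_compose _ _ (hA.sumElim hB), hAB, Matrix.mulVec_zero]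

namespace NormalCoordinates

variable {n d : ℕ} {M M' : GenericSubmanifold n d} (x : NormalCoordinates M) {σ : Type}

theorem chart_compose_inv_compose {A : FormalTuple σ (Fin (n + d))} (hA : FixesZero A) :
    compose x.chart (compose x.inv A) = A := by
  rw [← compose_assoc _ x.inv_zero hA, x.chart_inv, idTuple_compose hA]

theorem inv_compose_chart_compose {U : FormalTuple σ (Fin n ⊕ Fin d)} (hU : FixesZero U) :
    compose x.inv (compose x.chart U) = U := by
  rw [← compose_assoc _ x.chart_zero hU, x.inv_chart, idTuple_compose hU]

theorem rho_chart_compose {U V : FormalTuple σ (Fin n ⊕ Fin d)} (hU : FixesZero U)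
    (hV : FixesZero V) :
    compose M.rho (Sum.elim (compose x.chart U) (compose (conj x.chart) V)) =
      (x.a.map (subst (Sum.elim U V))).mulVec
        (U ∘ Sum.inr - compose x.Q (Sum.elim (U ∘ Sum.inl) V)) := by
  have hUV := hU.sumElim hV
  have sumElim_comp_map : Sum.elim U V ∘ Sum.map Sum.inl id = Sum.elim (U ∘ Sum.inl) V :=
    Sum.elim_comp_map
  rw [← complexify_compose _ hU hV, ← compose_assoc _ x.chart_zero.complexify hUV, x.equation,
    mulVec_compose _ _ hUV, compose_sub _ _ hUV, coords_compose _ hUV,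
    compose_assoc _ (fixesZero_coords _) hUV, coords_compose _ hUV, sumElim_comp_map]
  rfl

theorem isUnit_a_map_subst {U : FormalTuple σ ((Fin n ⊕ Fin d) ⊕ (Fin n ⊕ Fin d))}
    (hU : FixesZero U) : IsUnit (x.a.map (subst U)) := by
  rw [← coe_substAlgHom (R := ℂ) hU.hasSubst]
  exact x.a_isUnit.map (substAlgHom (R := ℂ) hU.hasSubst).toRingHom.mapMatrix

theorem Q_compose_mid {u : FormalTuple σ (Fin n)} {v : FormalTuple σ (Fin d)}
    (hu : FixesZero u) (hv : FixesZero v) :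
    compose x.Q (Sum.elim u (Sum.elim 0 v)) = v := by
  have huv := hu.sumElim hv
  have hmid : FixesZero (Sum.elim (coords Sum.inl) (Sum.elim 0 (coords Sum.inr)) :
      FormalTuple (Fin n ⊕ Fin d) (Fin n ⊕ (Fin n ⊕ Fin d))) :=
    (fixesZero_coords _).sumElim (fixesZero_zero.sumElim (fixesZero_coords _))
  calc
    compose x.Q (Sum.elim u (Sum.elim 0 v)) =
        compose (compose x.Q (Sum.elim (coords Sum.inl) (Sum.elim 0 (coords Sum.inr))))
          (Sum.elim u v) := by
      rw [compose_assoc _ hmid huv, sumElim_compose, sumElim_compose, zero_compose huv,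
        coords_compose _ huv, coords_compose _ huv, Sum.elim_comp_inl, Sum.elim_comp_inr]
    _ = compose (coords Sum.inr) (Sum.elim u v) := congr_arg (compose · _) x.Q_mid
    _ = v := by rw [coords_compose _ huv, Sum.elim_comp_inr]

theorem Q_compose_zero {u : FormalTuple σ (Fin n)} (hu : FixesZero u) :
    compose x.Q (Sum.elim u 0) = 0 := by
  simpa only [Sum.elim_zero_zero] using x.Q_compose_mid hu fixesZero_zero

theorem fixesZero_Q : FixesZero x.Q := fun j => by
  have h : compose x.Q (0 : FormalTuple (Fin 0) _) = 0 := by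
    simpa only [Sum.elim_zero_zero] using x.Q_compose_zero fixesZero_zero
  have hC : C (constantCoeff (x.Q j)) = (0 : MvPowerSeries (Fin 0) ℂ) :=
    subst_zero_eq_C_constantCoeff.symm.trans (congr_fun h j)
  simpa using congr_arg constantCoeff hC

theorem inv_inr_mem_compIdeal_rho {A : FormalTuple σ (Fin (n + d))} (hA : FixesZero A)
    (j : Fin d) :
    compose x.inv A (Sum.inr j) ∈ compIdeal (compose M.rho (Sum.elim A 0)) := by
  have hU := x.inv_zero.compose hA
  have h := x.rho_chart_compose hU fixesZero_zero
  rw [compose_zero x.chart_zero.conj, x.Q_compose_zero (hU.comp _), sub_zero,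
    x.chart_compose_inv_compose hA] at h
  rw [compIdeal, h]
  exact mem_span_mulVec (x.isUnit_a_map_subst (hU.sumElim fixesZero_zero)) _ j

/-- The parametrization `z ↦ Z(z, 0)` of the Segre variety `ρ(Z, 0) = 0` of `0`. -/
def segreChart : FormalTuple (Fin n) (Fin (n + d)) := compose x.chart (segreOne n d)

theorem fixesZero_segreChart : FixesZero x.segreChart :=
  x.chart_zero.compose (fixesZero_segreOne n d)

theorem inv_segreChart : compose x.inv x.segreChart = segreOne n d :=
  x.inv_compose_chart_compose (fixesZero_segreOne n d)

theorem rho_segreChart : compose M.rho (Sum.elim x.segreChart 0) = 0 := by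
  have h := x.rho_chart_compose (fixesZero_segreOne n d) fixesZero_zero
  rwa [compose_zero x.chart_zero.conj, x.Q_compose_zero ((fixesZero_segreOne n d).comp _),
    sub_zero, show segreOne n d ∘ Sum.inr = 0 from rfl, Matrix.mulVec_zero] at h

theorem segreChart_compose {u : FormalTuple σ (Fin n)} (hu : FixesZero u) :
    compose x.segreChart u = compose x.chart (Sum.elim u 0) := by
  rw [segreChart, compose_assoc _ (fixesZero_segreOne n d) hu, segreOne_compose d hu]

theorem segreChart_compose_inv {A : FormalTuple σ (Fin (n + d))} (hA : FixesZero A)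
    (hrho : compose M.rho (Sum.elim A 0) = 0) :
    compose x.segreChart (compose x.inv A ∘ Sum.inl) = A := by
  have hw (j) : compose x.inv A (Sum.inr j) = 0 := by
    have h := x.inv_inr_mem_compIdeal_rho hA j
    rw [hrho] at h
    simpa using compIdeal_le_iff.2 (fun _ => Ideal.zero_mem ⊥) h
  have hinv : Sum.elim (compose x.inv A ∘ Sum.inl) 0 = compose x.inv A :=
    funext <| Sum.rec (fun _ => rfl) fun j => (hw j).symm
  rw [x.segreChart_compose ((x.inv_zero.compose hA).comp _), hinv, x.chart_compose_inv_compose hA]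

theorem isFiniteMap_compose_segreChart_of_isFiniteMap (x' : NormalCoordinates M)
    {H : FormalTuple (Fin (n + d)) (Fin (n + d))} (hH : IsFiniteMap (compose H x.segreChart)) :
    IsFiniteMap (compose H x'.segreChart) := by
  let g := compose x.inv x'.segreChart ∘ Sum.inl
  let g' := compose x'.inv x.segreChart ∘ Sum.inl
  have hg : FixesZero g := (x.inv_zero.compose x'.fixesZero_segreChart).comp _
  have hg' : FixesZero g' := (x'.inv_zero.compose x.fixesZero_segreChart).comp _
  have hx : compose x.segreChart g = x'.segreChart :=
    x.segreChart_compose_inv x'.fixesZero_segreChart x'.rho_segreChart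
  have g'_g : compose g' g = idTuple (Fin n) := by
    change compose (compose x'.inv x.segreChart) g ∘ Sum.inl = _
    rw [compose_assoc _ x.fixesZero_segreChart hg, hx, x'.inv_segreChart]
    rfl
  rw [← hx, ← compose_assoc _ x.fixesZero_segreChart hg]
  exact hH.compose hg hg' g'_g

/-- The series `Q(z, χ, 0)`, with `z` indexed by `Sum.inl` and `χ` by `Sum.inr`. -/
def QZero : FormalTuple (Fin n ⊕ Fin n) (Fin d) :=
  compose x.Q (Sum.elim (coords Sum.inl) (Sum.elim (coords Sum.inr) 0))

theorem fixesZero_QZero : FixesZero x.QZero :=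
  x.fixesZero_Q.compose ((fixesZero_coords _).sumElim ((fixesZero_coords _).sumElim fixesZero_zero))

theorem QZero_compose {u v : FormalTuple σ (Fin n)} (hu : FixesZero u) (hv : FixesZero v) :
    compose x.QZero (Sum.elim u v) = compose x.Q (Sum.elim u (Sum.elim v 0)) := by
  have huv := hu.sumElim hv
  rw [QZero, compose_assoc _
    ((fixesZero_coords _).sumElim ((fixesZero_coords _).sumElim fixesZero_zero)) huv,
    sumElim_compose, sumElim_compose, coords_compose _ huv, coords_compose _ huv,
    zero_compose huv, Sum.elim_comp_inl, Sum.elim_comp_inr]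

theorem coeff_coeff_QZero (j : Fin d) (α : Fin n →₀ ℕ) :
    coeff α (sumToIter (x.QZero j)) = x.q j α := by
  let e : Fin n ⊕ Fin n ↪ Fin n ⊕ (Fin n ⊕ Fin d) :=
    (Function.Embedding.refl _).sumMap Function.Embedding.inl
  have inr_inr_notMem (i : Fin d) : Sum.inr (Sum.inr i) ∉ Set.range e := by
    rintro ⟨k | k, hk⟩ <;> simp [e] at hk
  have QZero_eq : x.QZero j = killCompl e (x.Q j) := by
    refine subst_eq_killCompl e ((fixesZero_coords _).sumElim
      ((fixesZero_coords _).sumElim fixesZero_zero)).hasSubst ?_ ?_ _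
    · rintro (i | i) <;> rfl
    · rintro (i | i | i) hi
      · exact absurd ⟨Sum.inl i, rfl⟩ hi
      · exact absurd ⟨Sum.inr i, rfl⟩ hi
      · rfl
  ext β
  have embDomain_eq : Finsupp.embDomain e (Finsupp.sumElim α β) =
      Finsupp.sumElim α (Finsupp.sumElim β 0) := by
    ext (i | i | i)
    · exact Finsupp.embDomain_apply_self e _ (Sum.inl i)
    · exact Finsupp.embDomain_apply_self e _ (Sum.inr i)
    · exact Finsupp.embDomain_of_notMem_range e _ _ (inr_inr_notMem i)
  rw [coeff_coeff_sumToIter, QZero_eq, coeff_killCompl, embDomain_eq]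
  rfl

/-- The mapping `(z, χ) ↦ Z(z, Q(z, χ, 0))`, which parametrizes the family of the Segre varieties
`ρ(Z, Z̄(χ, 0)) = 0`. -/
def segreTwoChart : FormalTuple (Fin n ⊕ Fin n) (Fin (n + d)) :=
  compose x.chart (Sum.elim (coords Sum.inl) x.QZero)

theorem fixesZero_segreTwoChart : FixesZero x.segreTwoChart :=
  x.chart_zero.compose ((fixesZero_coords _).sumElim x.fixesZero_QZero)

theorem inv_inr_segreTwoChart (j : Fin d) :
    compose x.inv x.segreTwoChart (Sum.inr j) = x.QZero j :=
  congr_fun (x.inv_compose_chart_compose ((fixesZero_coords _).sumElim x.fixesZero_QZero))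
    (Sum.inr j)

theorem segreTwoChart_compose_zero :
    compose x.segreTwoChart (Sum.elim (idTuple (Fin n)) 0) = x.segreChart := by
  have h : FixesZero (Sum.elim (idTuple (Fin n)) 0 : FormalTuple (Fin n) (Fin n ⊕ Fin n)) :=
    fixesZero_idTuple.sumElim fixesZero_zero
  rw [segreTwoChart, compose_assoc _ ((fixesZero_coords _).sumElim x.fixesZero_QZero) h,
    sumElim_compose, coords_compose _ h, Sum.elim_comp_inl,
    x.QZero_compose fixesZero_idTuple fixesZero_zero,
    x.Q_compose_mid fixesZero_idTuple fixesZero_zero]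
  rfl

theorem rho_segreTwoChart :
    compose M.rho
      (Sum.elim x.segreTwoChart (compose (conj x.segreChart) (coords Sum.inr))) = 0 := by
  have hχ : FixesZero (coords Sum.inr : FormalTuple (Fin n ⊕ Fin n) (Fin n)) := fixesZero_coords _
  have hs := fixesZero_segreOne n d
  have conj_segreChart : compose (conj x.segreChart) (coords Sum.inr) =
      compose (conj x.chart) (Sum.elim (coords Sum.inr : FormalTuple (Fin n ⊕ Fin n) _) 0) := by
    rw [segreChart, conj_compose _ hs, conj_segreOne, compose_assoc _ hs hχ,
      segreOne_compose d hχ]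
  rw [conj_segreChart, segreTwoChart, x.rho_chart_compose
    ((fixesZero_coords _).sumElim x.fixesZero_QZero) (hχ.sumElim fixesZero_zero),
    Sum.elim_comp_inl, Sum.elim_comp_inr, ← QZero, sub_self, Matrix.mulVec_zero]

section Fiber

variable {R : Type*} [CommRing R] {θ : MvPowerSeries (Fin n) ℂ →+* R}
  {H : FormalTuple (Fin (n + d)) (Fin (n + d))}

theorem fiberHom_rho (hH : FixesZero H) (hMM' : MapsInto H M M')
    (hθ : ∀ i, θ (conj (compose H x.segreChart) i) = 0) (k : Fin d) :
    fiberHom θ (compose M'.rho (Sum.elim (compose H x.segreTwoChart) 0) k) = 0 := by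
  have hA := hH.compose x.fixesZero_segreTwoChart
  have hχ : FixesZero (coords Sum.inr : FormalTuple (Fin n ⊕ Fin n) (Fin n)) := fixesZero_coords _
  have hB := x.fixesZero_segreChart.conj.compose hχ
  have rho_eq_zero :=
    hMM'.rho_compose_eq_zero hH x.fixesZero_segreTwoChart hB x.rho_segreTwoChart
  have conj_mem_ker (i : Fin (n + d)) :
      compose (conj H) (compose (conj x.segreChart) (coords Sum.inr)) i ∈
        RingHom.ker (fiberHom (σ := Fin n) θ) := by
    rw [← compose_assoc _ x.fixesZero_segreChart.conj hχ,
      ← conj_compose _ x.fixesZero_segreChart, RingHom.mem_ker]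
    exact (fiberHom_subst_X_inr θ _).trans (by rw [hθ, map_zero])
  have sub_mem_ker := subst_sub_subst_mem (I := RingHom.ker (fiberHom (σ := Fin n) θ))
    (hA.sumElim (hH.conj.compose hB)) (hA.sumElim fixesZero_zero)
    (Sum.rec (fun i => by simp only [Sum.elim_inl, sub_self, zero_mem])
      fun i => by simpa only [Sum.elim_inr, Pi.zero_apply, sub_zero] using conj_mem_ker i)
    (M'.rho k)
  have := congr_fun rho_eq_zero k
  rw [compose, Pi.zero_apply] at this
  rwa [this, zero_sub, neg_mem_iff] at sub_mem_ker

theorem fiberHom_compG (hH : FixesZero H) (hMM' : MapsInto H M M')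
    (hθ : ∀ i, θ (conj (compose H x.segreChart) i) = 0) (y : NormalCoordinates M') (j : Fin d) :
    fiberHom θ (subst x.segreTwoChart (y.compG H j)) = 0 := by
  have hle : compIdeal (compose M'.rho (Sum.elim (compose H x.segreTwoChart) 0)) ≤
      RingHom.ker (fiberHom θ) :=
    compIdeal_le_iff.2 (x.fiberHom_rho hH hMM' hθ)
  have h := hle (y.inv_inr_mem_compIdeal_rho (hH.compose x.fixesZero_segreTwoChart) j)
  rwa [← compose_assoc _ hH x.fixesZero_segreTwoChart] at h

theorem exists_fiberHom_QZero_ne_zero [IsDomain R] (hx : FiniteCodim x.essentialIdeal)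
    (hθ : ∃ i, θ (X i) ≠ 0) : ∃ j, fiberHom θ (x.QZero j) ≠ 0 := by
  by_contra! hQ
  have : (RingHom.ker θ).IsPrime := RingHom.ker_isPrime θ
  have : Module.Finite ℂ (MvPowerSeries (Fin n) ℂ ⧸ x.essentialIdeal) := hx
  have hle : x.essentialIdeal ≤ RingHom.ker θ := by
    rw [essentialIdeal, Ideal.span_le]
    rintro _ ⟨⟨j, α⟩, rfl⟩
    change θ (x.q j α) = 0
    rw [← x.coeff_coeff_QZero, ← coeff_fiberHom, hQ, map_zero]
  obtain ⟨i, hi⟩ := hθ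
  exact hi (X_mem_prime_of_finite_quotient hle i)

theorem natCast_add_one_le_ringKrullDim_compG [IsDomain R] (hH : FixesZero H)
    (hMM' : MapsInto H M M') (hx : FiniteCodim x.essentialIdeal) (y : NormalCoordinates M')
    (hθ : ∀ i, θ (conj (compose H x.segreChart) i) = 0) (hθX : ∃ i, θ (X i) ≠ 0) :
    (n : WithBot ℕ∞) + 1 ≤
      ringKrullDim (MvPowerSeries (Fin (n + d)) ℂ ⧸ compIdeal (y.compG H)) := by
  have h₁ := x.fixesZero_segreChart
  have h₂ := x.fixesZero_segreTwoChart
  let ε : MvPowerSeries (Fin (n + d)) ℂ →+* MvPowerSeries (Fin n) ℂ :=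
    (substAlgHom (R := ℂ) h₁.hasSubst).toRingHom
  let Φ : MvPowerSeries (Fin (n + d)) ℂ →+* MvPowerSeries (Fin n) R :=
    (fiberHom θ).comp (substAlgHom (R := ℂ) h₂.hasSubst).toRingHom
  have ε_apply (f) : ε f = subst x.segreChart f := substAlgHom_apply _ f
  have Φ_apply (f) : Φ f = fiberHom θ (subst x.segreTwoChart f) :=
    congr_arg (fiberHom θ) (substAlgHom_apply _ f)
  have compG_le : compIdeal (y.compG H) ≤ RingHom.ker Φ := compIdeal_le_iff.2 fun j =>
    (Φ_apply _).trans (x.fiberHom_compG hH hMM' hθ y j)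
  have ε_surjective : Function.Surjective ε :=
    surjective_substAlgHom h₁ (x.inv_zero.comp Sum.inl) <|
      congr_arg (· ∘ Sum.inl) x.inv_segreChart
  have ker_le : RingHom.ker Φ ≤ RingHom.ker ε := fun f hf => by
    rw [RingHom.mem_ker, Φ_apply] at hf
    have h := subst_sumElim_X_zero_eq_zero hf
    rw [subst_comp_subst_apply h₂.hasSubst hasSubst_sumElim_X_zero] at h
    rw [RingHom.mem_ker, ε_apply, ← x.segreTwoChart_compose_zero]
    exact h
  obtain ⟨j, hj⟩ := x.exists_fiberHom_QZero_ne_zero hx hθX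
  have Φ_ne_zero : Φ (x.inv (Sum.inr j)) ≠ 0 := by
    rwa [Φ_apply, show subst x.segreTwoChart (x.inv (Sum.inr j)) = _ from x.inv_inr_segreTwoChart j]
  have ε_eq_zero : ε (x.inv (Sum.inr j)) = 0 :=
    (ε_apply _).trans (congr_fun x.inv_segreChart (Sum.inr j))
  have : IsDomain (MvPowerSeries (Fin n) R) := NoZeroDivisors.to_isDomain _
  calc
    (n : WithBot ℕ∞) + 1 ≤ ringKrullDim (MvPowerSeries (Fin n) ℂ) + 1 := by
      gcongr
      exact natCast_le_ringKrullDim n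
    _ ≤ _ := ringKrullDim_add_one_le_quotient compG_le ε_surjective ker_le Φ_ne_zero ε_eq_zero

end Fiber

variable {H : FormalTuple (Fin (n + d)) (Fin (n + d))}

theorem isFiniteMap_compose_segreChart (hH : FixesZero H) (hMM' : MapsInto H M M')
    (hx : FiniteCodim x.essentialIdeal) (y : NormalCoordinates M')
    (hy : ringKrullDim (MvPowerSeries (Fin (n + d)) ℂ ⧸ compIdeal (y.compG H)) ≤ n) :
    IsFiniteMap (compose H x.segreChart) := by
  refine finite_quotient_of_X_mem_prime _ fun P _ hP i => ?_
  by_contra hi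
  let θ : MvPowerSeries (Fin n) ℂ →+* MvPowerSeries (Fin n) ℂ ⧸ P :=
    (Ideal.Quotient.mk P).comp (map (starRingEnd ℂ))
  have hθ (k) : θ (conj (compose H x.segreChart) k) = 0 := by
    rw [RingHom.comp_apply, conj, map_conj_conj, Ideal.Quotient.eq_zero_iff_mem]
    exact hP (mem_compIdeal _ k)
  have hθX : θ (X i) ≠ 0 := by
    rwa [RingHom.comp_apply, map_X, Ne, Ideal.Quotient.eq_zero_iff_mem]
  have hdim : (n : WithBot ℕ∞) + 1 ≤ n :=
    (x.natCast_add_one_le_ringKrullDim_compG hH hMM' hx y hθ ⟨i, hθX⟩).trans hy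
  exact Nat.not_succ_le_self n (by exact_mod_cast hdim)

theorem compIdeal_compose_segreChart_le (hH : FixesZero H) (hMM' : MapsInto H M M')
    (y : NormalCoordinates M') :
    compIdeal (compose H x.segreChart) ≤
      compIdeal (compose (compose (y.compF H) x.chart) (segreOne n d)) := by
  have hs := fixesZero_segreOne n d
  have hHs := hH.compose x.fixesZero_segreChart
  have compF_eq : compose (compose (y.compF H) x.chart) (segreOne n d) =
      compose y.inv (compose H x.segreChart) ∘ Sum.inl := by
    rw [compose_assoc _ x.chart_zero hs, ← segreChart, compF,
      compose_assoc _ hH x.fixesZero_segreChart]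
    rfl
  have rho_eq_zero := hMM'.rho_compose_eq_zero hH x.fixesZero_segreChart fixesZero_zero
    x.rho_segreChart
  rw [compose_zero hH.conj] at rho_eq_zero
  rw [compF_eq]
  nth_rw 1 [← y.segreChart_compose_inv hHs rho_eq_zero]
  exact compIdeal_compose_le y.fixesZero_segreChart ((y.inv_zero.compose hHs).comp _)

end NormalCoordinates

end FormalCR

end

theorem theorem6p4 {n d : ℕ} (M M' : FormalCR.GenericSubmanifold n d)
    (H : FormalCR.FormalTuple (Fin (n + d)) (Fin (n + d))) (hH : FormalCR.FixesZero H)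
    (hMM' : FormalCR.MapsInto H M M') (hM : FormalCR.EssentiallyFinite M)
    (hreg : FormalCR.TransversallyRegular H M') :
    FormalCR.SegreFinite H M M' := by
  obtain ⟨x, hx⟩ := hM
  obtain ⟨y, hy⟩ := hreg
  intro x' y'
  have finite_x : FormalCR.IsFiniteMap (FormalCR.compose H x.segreChart) :=
    x.isFiniteMap_compose_segreChart hH hMM' hx y hy.le
  have finite_x' : FormalCR.IsFiniteMap (FormalCR.compose H x'.segreChart) :=
    x.isFiniteMap_compose_segreChart_of_isFiniteMap x' finite_x
  exact finite_x'.mono (x'.compIdeal_compose_segreChart_le hH hMM' y')
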